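/- For a partition $\lambda$ of length at most $k$, let $$P_\lambda(x_1,\dots,x_k;t)=\sum_{w\in S_k/S_k^\lambda} w\bigg(x_1^{\lambda_1}\cdots x_k^{\lambda_k}\prod_{\lambda_i>\lambda_j}\frac{x_i-tx_j}{x_i-x_j}\bigg)\in\mathbb{Z}[t][x_1,\dots,x_k]$$ be the Hall--Littlewood polynomial, where $S_k^\lambda$ is the stabiliser of $\lambda$ in $S_k$, and let $P_\lambda(x_1,x_2,\dots;t)$ be the corresponding Hall--Littlewood symmetric function in countably many variables, in which the coefficient of each monomial is its coefficient in $P_\lambda(x_1,\dots,x_k;t)$ for all sufficiently large $k$. For an integer $b\geq 1$ let $(q^b;q^b)_m=\prod_{i=1}^{m}(1-q^{bi})$ if $m\geq 0$, and $1/(q^b;q^b)_m:=0$ if $m<0$. Let $(2^r)$ be the partition with $r$ parts, all equal to $2$. Then for all nonnegative integers $r,n$ and all $\delta\in\{0,1\}$, the following identity holds in the ring $\mathbb{Z}[[q]]$ of formal power series, where $r_0:=r$: $$P_{(2^r)}\big(1,q,q^2,\dots;q^{2n+\delta}\big)=\sum_{r_1,\dots,r_n\geq 0}\frac{q^{r^2-r+r_1^2+\dots+r_n^2+r_1+\dots+r_n}}{(q;q)_{r_0-r_1}(q;q)_{r_1-r_2}\cdots(q;q)_{r_{n-1}-r_n}\,(q^{2-\delta};q^{2-\delta})_{r_n}}.$$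 Here the left-hand side is the (convergent) sum of the power series obtained by substituting $x_i=q^{i-1}$ and $t=q^{2n+\delta}$ in the individual monomial terms of the symmetric function; only finitely many terms on the right are nonzero, and for $n=0$ the right-hand side is $q^{r^2-r}/(q^{2-\delta};q^{2-\delta})_r$. -/

import Mathlib

open scoped PowerSeries.WithPiTopology

namespace HallLittlewood

noncomputable section

/-- The ring `ℤ[t][x₁, …, x_k]`; the parameter `t` is `Polynomial.X`. -/
abbrev Poly (k : ℕ) : Type := MvPolynomial (Fin k) (Polynomial ℤ)

/-- The field of rational functions in `x₁, …, x_k` and `t`. -/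
abbrev RatFun (k : ℕ) : Type := FractionRing (Poly k)

/-- The variable `x_i` as a rational function. -/
def x {k : ℕ} (i : Fin k) : RatFun k := algebraMap (Poly k) (RatFun k) (MvPolynomial.X i)

/-- The parameter `t` as a rational function. -/
def t (k : ℕ) : RatFun k := algebraMap (Poly k) (RatFun k) (MvPolynomial.C Polynomial.X)

/-- The subgroup `S_k^λ` of all permutations in `S_k` that fix `λ = (λ₁, …, λ_k)`. -/
def stab {k : ℕ} (lam : Fin k → ℕ) : Subgroup (Equiv.Perm (Fin k)) where
  carrier := {w | ∀ i, lam (w i) = lam i}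
  mul_mem' {a b} ha hb i := by
    change lam (a (b i)) = lam i
    rw [ha, hb]
  one_mem' i := rfl
  inv_mem' {a} ha i := by
    have h := ha (a⁻¹ i)
    rw [← Equiv.Perm.mul_apply, mul_inv_cancel, Equiv.Perm.one_apply] at h
    exact h.symm

/-- The rational function
`w (x₁ ^ λ₁ ⋯ x_k ^ λ_k ∏_{λ_i > λ_j} (x_i - t x_j) / (x_i - x_j))`,
where the permutation `w` acts by `x_i ↦ x_{w(i)}`. -/
def term {k : ℕ} (lam : Fin k → ℕ) (w : Equiv.Perm (Fin k)) : RatFun k :=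
  (∏ i, x (w i) ^ lam i) *
    ∏ p : Fin k × Fin k with lam p.2 < lam p.1,
      (x (w p.1) - t k * x (w p.2)) / (x (w p.1) - x (w p.2))

theorem term_mul_of_mem_stab {k : ℕ} (lam : Fin k → ℕ) (w s : Equiv.Perm (Fin k))
    (hs : s ∈ stab lam) : term lam (w * s) = term lam w := by
  have hs' : ∀ i, lam (s i) = lam i := hs
  unfold term
  congr 1
  · refine Fintype.prod_equiv s _ _ fun i => ?_
    rw [hs', Equiv.Perm.mul_apply]
  · refine Finset.prod_equiv (Equiv.prodCongr s s) (fun p => ?_) (fun p _ => ?_)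
    · simp [hs']
    · simp [Equiv.Perm.mul_apply]

/-- The summand, as a function on the cosets `S_k / S_k^λ`. -/
def cosetTerm {k : ℕ} (lam : Fin k → ℕ) (c : Equiv.Perm (Fin k) ⧸ stab lam) : RatFun k :=
  Quotient.liftOn' c (term lam) fun a b hab => by
    have h := term_mul_of_mem_stab lam a (a⁻¹ * b) (QuotientGroup.leftRel_apply.mp hab)
    rw [mul_inv_cancel_left] at h
    exact h.symm

open Classical in
/-- The Hall–Littlewood polynomial `P_λ(x₁, …, x_k; t)`, as a rational function:
the sum of the `w`-images over `w ∈ S_k / S_k^λ`. -/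
def ratP {k : ℕ} (lam : Fin k → ℕ) : RatFun k :=
  ∑ c : Equiv.Perm (Fin k) ⧸ stab lam, cosetTerm lam c

/-! ### `ratP lam` is a polynomial -/

/-- The substitution `x_i ↦ x_j`. -/
def merge {k : ℕ} (i j : Fin k) : Poly k →ₐ[Polynomial ℤ] Poly k :=
  MvPolynomial.aeval (Function.update MvPolynomial.X i (MvPolynomial.X j))

theorem sub_dvd_iff {k : ℕ} (i j : Fin k) (p : Poly k) :
    (MvPolynomial.X i - MvPolynomial.X j : Poly k) ∣ p ↔ merge i j p = 0 := by
  constructor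
  · rintro ⟨a, rfl⟩
    by_cases h : j = i
    · subst h; simp
    · simp [merge, Function.update_of_ne h]
  · intro h
    rw [← Ideal.mem_span_singleton, ← Ideal.Quotient.eq_zero_iff_mem]
    set I : Ideal (Poly k) := Ideal.span {MvPolynomial.X i - MvPolynomial.X j} with hI
    have key : (Ideal.Quotient.mkₐ (Polynomial ℤ) I).comp (merge i j)
        = Ideal.Quotient.mkₐ (Polynomial ℤ) I := by
      refine MvPolynomial.algHom_ext fun l => ?_
      by_cases hl : l = i
      · subst hl
        simp only [merge, AlgHom.comp_apply, MvPolynomial.aeval_X, Function.update_self,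
          Ideal.Quotient.mkₐ_eq_mk]
        rw [eq_comm, Ideal.Quotient.eq]
        exact Ideal.mem_span_singleton_self _
      · simp [merge, Function.update_of_ne hl]
    have h2 := DFunLike.congr_fun key p
    simpa [h] using h2.symm

theorem sub_ne_zero {k : ℕ} {i j : Fin k} (hij : i ≠ j) :
    (MvPolynomial.X i - MvPolynomial.X j : Poly k) ≠ 0 :=
  fun h => hij (MvPolynomial.X_injective (sub_eq_zero.mp h))

theorem prime_sub {k : ℕ} {i j : Fin k} (hij : i ≠ j) :
    Prime (MvPolynomial.X i - MvPolynomial.X j : Poly k) := by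
  refine ⟨sub_ne_zero hij, fun h => ?_, fun a b h => ?_⟩
  · have := (sub_dvd_iff i j 1).mp h.dvd
    simp at this
  · rw [sub_dvd_iff, map_mul, mul_eq_zero] at h
    rwa [sub_dvd_iff, sub_dvd_iff]

theorem isRelPrime_sub {k : ℕ} {i j i' j' : Fin k} (hij : i ≠ j) (hij' : i' ≠ j')
    (h1 : ¬(i' = i ∧ j' = j)) (h2 : ¬(i' = j ∧ j' = i)) :
    IsRelPrime (MvPolynomial.X i - MvPolynomial.X j : Poly k)
      (MvPolynomial.X i' - MvPolynomial.X j') := by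
  rw [(prime_sub hij).irreducible.isRelPrime_iff_not_dvd, sub_dvd_iff]
  simp only [merge, map_sub, MvPolynomial.aeval_X, Function.update_apply]
  have inj := MvPolynomial.X_injective (σ := Fin k) (R := Polynomial ℤ)
  split_ifs with ha hb hb <;> rw [sub_eq_zero] <;> intro h <;> have h := inj h <;> grind

theorem prod_sub_dvd {k : ℕ} (s : Finset (Fin k × Fin k)) (hs : ∀ p ∈ s, p.1 ≠ p.2)
    (hs' : ∀ p ∈ s, p.swap ∉ s) (V : Poly k)
    (hV : ∀ p ∈ s, (MvPolynomial.X p.1 - MvPolynomial.X p.2 : Poly k) ∣ V) :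
    (∏ p ∈ s, (MvPolynomial.X p.1 - MvPolynomial.X p.2 : Poly k)) ∣ V := by
  refine Finset.prod_dvd_of_isRelPrime (fun p hp p' hp' hne => ?_) hV
  refine isRelPrime_sub (hs p hp) (hs p' hp') (fun h => hne ?_) (fun h => hs' p hp ?_)
  · exact Prod.ext h.1.symm h.2.symm
  · have : p.swap = p' := Prod.ext h.1.symm h.2.symm
    rwa [this]

/-- The Vandermonde product `∏_{i < j} (x_j - x_i)`. -/
def vdm (k : ℕ) : Poly k :=
  (Matrix.vandermonde (MvPolynomial.X : Fin k → Poly k)).det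

theorem vdm_eq (k : ℕ) :
    vdm k = ∏ p : Fin k × Fin k with p.2 < p.1,
      (MvPolynomial.X p.1 - MvPolynomial.X p.2 : Poly k) := by
  rw [vdm, Matrix.det_vandermonde, Finset.prod_sigma']
  refine Finset.prod_bij' (fun a _ => (a.2, a.1)) (fun p _ => ⟨p.2, p.1⟩) ?_ ?_ ?_ ?_ ?_ <;> simp

theorem vdm_ne_zero (k : ℕ) : vdm k ≠ 0 :=
  Matrix.det_vandermonde_ne_zero_iff.mpr MvPolynomial.X_injective

theorem rename_vdm {k : ℕ} (s : Equiv.Perm (Fin k)) :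
    MvPolynomial.rename s (vdm k) = ((Equiv.Perm.sign s : ℤ) : Poly k) * vdm k := by
  rw [vdm, ← Matrix.det_permute]
  change (MvPolynomial.rename s : Poly k →ₐ[Polynomial ℤ] Poly k).toRingHom _ = _
  rw [RingHom.map_det]
  congr 1
  ext1 a b
  simp [Matrix.vandermonde_apply, Matrix.submatrix_apply]

theorem merge_eq_zero_of_rename {k : ℕ} {i j : Fin k} (p : Poly k)
    (hp : MvPolynomial.rename (Equiv.swap i j) p = -p) : merge i j p = 0 := by
  have key : (merge i j).comp (MvPolynomial.rename (Equiv.swap i j)) = merge i j := by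
    refine MvPolynomial.algHom_ext fun l => ?_
    simp only [merge, AlgHom.comp_apply, MvPolynomial.rename_X, MvPolynomial.aeval_X,
      Function.update_apply, Equiv.swap_apply_def]
    split_ifs <;> simp_all
  have h := DFunLike.congr_fun key p
  rw [AlgHom.comp_apply, hp, map_neg] at h
  exact self_eq_neg.mp h.symm

theorem sub_dvd_vdm {k : ℕ} {i j : Fin k} (hij : i ≠ j) :
    (MvPolynomial.X i - MvPolynomial.X j : Poly k) ∣ vdm k := by
  rw [sub_dvd_iff]
  apply merge_eq_zero_of_rename
  rw [rename_vdm, Equiv.Perm.sign_swap hij]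
  simp only [Units.val_neg, Units.val_one, Int.cast_neg, Int.cast_one]
  ring

theorem exists_vdm_mul_term {k : ℕ} (lam : Fin k → ℕ) (w : Equiv.Perm (Fin k)) :
    ∃ g : Poly k, algebraMap (Poly k) (RatFun k) g = algebraMap (Poly k) (RatFun k) (vdm k) * term lam w := by
  set s : Finset (Fin k × Fin k) := Finset.univ.filter fun p => lam p.2 < lam p.1 with hs
  have hdvd : (∏ p ∈ s, (MvPolynomial.X (w p.1) - MvPolynomial.X (w p.2) : Poly k)) ∣ vdm k := by
    have h := prod_sub_dvd (s.map (Equiv.prodCongr w w).toEmbedding) ?_ ?_ (vdm k) ?_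
    · simpa [Finset.prod_map] using h
    · intro p hp
      obtain ⟨a, ha, rfl⟩ := Finset.mem_map.mp hp
      have ha : lam a.2 < lam a.1 := by simpa [hs] using ha
      intro h
      have : a.1 = a.2 := w.injective h
      rw [this] at ha
      exact lt_irrefl _ ha
    · intro p hp hp'
      obtain ⟨a, ha, rfl⟩ := Finset.mem_map.mp hp
      obtain ⟨b, hb, hab⟩ := Finset.mem_map.mp hp'
      have ha : lam a.2 < lam a.1 := by simpa [hs] using ha
      have hb : lam b.2 < lam b.1 := by simpa [hs] using hb
      have h1 : b.1 = a.2 := w.injective (congrArg Prod.fst hab)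
      have h2 : b.2 = a.1 := w.injective (congrArg Prod.snd hab)
      rw [h1, h2] at hb
      exact lt_asymm ha hb
    · intro p hp
      obtain ⟨a, ha, rfl⟩ := Finset.mem_map.mp hp
      have ha : lam a.2 < lam a.1 := by simpa [hs] using ha
      refine sub_dvd_vdm fun h => ?_
      have : a.1 = a.2 := w.injective h
      rw [this] at ha
      exact lt_irrefl _ ha
  obtain ⟨u, hu⟩ := hdvd
  refine ⟨(∏ i, MvPolynomial.X (w i) ^ lam i) *
    (∏ p ∈ s, (MvPolynomial.X (w p.1) - MvPolynomial.C Polynomial.X * MvPolynomial.X (w p.2))) * u,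
    ?_⟩
  have hne : (∏ p ∈ s, (x (w p.1) - x (w p.2) : RatFun k)) ≠ 0 := by
    refine Finset.prod_ne_zero_iff.mpr fun p hp h => ?_
    have hp : lam p.2 < lam p.1 := by simpa [hs] using hp
    have h := MvPolynomial.X_injective
      (IsFractionRing.injective (Poly k) (RatFun k) (_root_.sub_eq_zero.mp h))
    have : p.1 = p.2 := w.injective h
    rw [this] at hp
    exact lt_irrefl _ hp
  rw [hu, term, Finset.prod_div_distrib, ← hs]
  simp only [map_mul, map_prod, map_pow, map_sub]
  change (∏ i, x (w i) ^ lam i) * (∏ p ∈ s, (x (w p.1) - t k * x (w p.2))) * _ =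
    (∏ p ∈ s, (x (w p.1) - x (w p.2) : RatFun k)) * _ * _
  field_simp

/-- The automorphism `x_i ↦ x_{s(i)}` of the field of rational functions. -/
def permRat {k : ℕ} (s : Equiv.Perm (Fin k)) : RatFun k ≃+* RatFun k :=
  IsFractionRing.ringEquivOfRingEquiv (MvPolynomial.renameEquiv (Polynomial ℤ) s).toRingEquiv

theorem permRat_algebraMap {k : ℕ} (s : Equiv.Perm (Fin k)) (p : Poly k) :
    permRat s (algebraMap (Poly k) (RatFun k) p) =
      algebraMap (Poly k) (RatFun k) (MvPolynomial.rename s p) := by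
  rw [permRat, IsFractionRing.ringEquivOfRingEquiv_algebraMap]
  rfl

theorem permRat_term {k : ℕ} (lam : Fin k → ℕ) (s w : Equiv.Perm (Fin k)) :
    permRat s (term lam w) = term lam (s * w) := by
  simp [term, x, t, permRat_algebraMap]

theorem permRat_ratP {k : ℕ} (lam : Fin k → ℕ) (s : Equiv.Perm (Fin k)) :
    permRat s (ratP lam) = ratP lam := by
  classical
  rw [ratP, map_sum]
  refine Fintype.sum_equiv (MulAction.toPerm s) _ _ fun c => ?_
  induction c using Quotient.inductionOn' with
  | h w => exact permRat_term lam s w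

theorem exists_poly {k : ℕ} (lam : Fin k → ℕ) :
    ∃ P : Poly k, algebraMap (Poly k) (RatFun k) P = ratP lam := by
  classical
  have h1 : ∀ c : Equiv.Perm (Fin k) ⧸ stab lam, ∃ g : Poly k,
      algebraMap (Poly k) (RatFun k) g = algebraMap (Poly k) (RatFun k) (vdm k) * cosetTerm lam c := by
    intro c
    induction c using Quotient.inductionOn' with
    | h w => exact exists_vdm_mul_term lam w
  choose g hg using h1
  have hG : algebraMap (Poly k) (RatFun k) (∑ c, g c) =
      algebraMap (Poly k) (RatFun k) (vdm k) * ratP lam := by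
    rw [map_sum, ratP, Finset.mul_sum]
    exact Finset.sum_congr rfl fun c _ => hg c
  have hdvd : vdm k ∣ ∑ c, g c := by
    conv_lhs => rw [vdm_eq]
    refine prod_sub_dvd _ (fun p hp => ?_) (fun p hp hp' => ?_) _ (fun p hp => ?_)
    · exact (by simpa using hp : p.2 < p.1).ne'
    · exact lt_asymm (by simpa using hp : p.2 < p.1) (by simpa using hp')
    · have hne : p.1 ≠ p.2 := (by simpa using hp : p.2 < p.1).ne'
      rw [sub_dvd_iff]
      apply merge_eq_zero_of_rename
      apply IsFractionRing.injective (Poly k) (RatFun k)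
      rw [← permRat_algebraMap, hG, map_mul, permRat_ratP, permRat_algebraMap, rename_vdm,
        Equiv.Perm.sign_swap hne, map_neg, hG]
      simp
  obtain ⟨P, hP⟩ := hdvd
  refine ⟨P, ?_⟩
  rw [hP, map_mul] at hG
  refine mul_left_cancel₀ ?_ hG
  rw [Ne, IsFractionRing.to_map_eq_zero_iff]
  exact vdm_ne_zero k

/-! ### Hall–Littlewood polynomials and functions -/

/-- The Hall–Littlewood polynomial `P_λ(x₁, …, x_k; t) ∈ ℤ[t][x₁, …, x_k]`, that is, the unique
polynomial that is equal to the rational function `ratP lam`. -/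
def polyP {k : ℕ} (lam : Fin k → ℕ) : Poly k := (exists_poly lam).choose

theorem algebraMap_polyP {k : ℕ} (lam : Fin k → ℕ) :
    algebraMap (Poly k) (RatFun k) (polyP lam) = ratP lam := (exists_poly lam).choose_spec

/-- The Hall–Littlewood symmetric function `P_λ(x₁, x₂, …; t)` in countably many variables, as a
formal power series over `ℤ[t]` (the variable `x_{i+1}` has index `i`). By stability the
coefficient of a monomial is its coefficient in `P_λ(x₁, …, x_k; t)` for any `k ≥ l(λ)` such that
only `x₁, …, x_k` occur in the monomial; the least such `k` is taken.
Here `lam.rowLen i` is `λ_{i+1}` and `lam.colLen 0` is the length `l(λ)`. -/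
def symP (lam : YoungDiagram) : MvPowerSeries ℕ (Polynomial ℤ) := fun m =>
  MvPolynomial.coeff
    (m.comapDomain Fin.val Fin.val_injective.injOn)
    (polyP fun i : Fin (max (lam.colLen 0) (m.support.sup (· + 1))) => lam.rowLen i)

/-- The statement `f(1, q, q², …; T) = s` in `ℤ⟦q⟧`, for a formal power series `f` in countably
many variables over `ℤ[t]`: substituting `x_{i+1} = q ^ i` and `t = T` in all terms of `f` gives a
summable family with sum `s`. (`ℤ⟦q⟧` has the topology of coefficientwise convergence, with `ℤ`
discrete.) -/
def HasPrincipalSpecialization (f : MvPowerSeries ℕ (Polynomial ℤ)) (T s : PowerSeries ℤ) : Prop :=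
  HasSum (fun m : ℕ →₀ ℕ =>
    Polynomial.aeval T (MvPowerSeries.coeff m f) *
      m.prod fun i e => ((PowerSeries.X : PowerSeries ℤ) ^ i) ^ e) s

/-- The partition `(2^r)`, with `r` parts equal to `2`. -/
def twoPow (r : ℕ) : YoungDiagram :=
  YoungDiagram.ofRowLens (List.replicate r 2) (List.pairwise_replicate_of_refl.sortedGE)

/-- The `q`-shifted factorial `(a; q)_m = ∏_{i < m} (1 - a q ^ i)`. -/
def qPoch (a q : PowerSeries ℤ) (m : ℕ) : PowerSeries ℤ := ∏ i ∈ Finset.range m, (1 - a * q ^ i)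

/-- For `b ≥ 1` the series `(q^b; q^b)_m` is invertible in `ℤ⟦q⟧`. -/
theorem isUnit_qPoch {b : ℕ} (hb : 0 < b) (m : ℕ) :
    IsUnit (qPoch (PowerSeries.X ^ b) (PowerSeries.X ^ b) m) := by
  rw [PowerSeries.isUnit_iff_constantCoeff, qPoch, map_prod]
  simp [hb.ne']

/-- `1 / (q^b; q^b)_m` in `ℤ⟦q⟧` for `b ≥ 1` and an integer `m`, which is `0` for `m < 0`. -/
def invQPoch (b : ℕ) (m : ℤ) : PowerSeries ℤ :=
  if 0 ≤ m then Ring.inverse (qPoch (PowerSeries.X ^ b) (PowerSeries.X ^ b) m.toNat) else 0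

/-- The summand of the multisum at `(r₁, …, r_n)`, with `r₀ = r`:
`q^(r² - r + r₁² + ⋯ + r_n² + r₁ + ⋯ + r_n)` divided by
`(q; q)_{r₀ - r₁} ⋯ (q; q)_{r_{n-1} - r_n} (q^b; q^b)_{r_n}`. -/
def summand (r n b : ℕ) (ρ : Fin n → ℕ) : PowerSeries ℤ :=
  let c : Fin (n + 1) → ℕ := Fin.cons r ρ
  PowerSeries.X ^ (r ^ 2 - r + ∑ i, (ρ i ^ 2 + ρ i)) *
    (∏ i : Fin n, invQPoch 1 ((c i.castSucc : ℤ) - (c i.succ : ℤ))) * invQPoch b (c (Fin.last n))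

/-- Only finitely many summands are nonzero. -/
theorem finite_support_summand (r n b : ℕ) : (Function.support (summand r n b)).Finite := by
  refine (Set.Finite.pi' fun _ : Fin n => Set.finite_Iic r).subset fun ρ hρ i => ?_
  by_contra hi
  apply hρ
  set c : Fin (n + 1) → ℕ := Fin.cons r ρ with hc
  have hex : ∃ i : Fin n, c i.castSucc < c i.succ := by
    by_contra! h
    have hanti : Antitone c := Fin.antitone_iff_succ_le.mpr h
    have h0 := hanti (Fin.zero_le i.succ)
    simp only [hc, Fin.cons_succ, Fin.cons_zero] at h0
    exact hi h0
  obtain ⟨l, hl⟩ := hex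
  have hz : ∏ i : Fin n, invQPoch 1 ((c i.castSucc : ℤ) - (c i.succ : ℤ)) = 0 := by
    refine Finset.prod_eq_zero (Finset.mem_univ l) ?_
    rw [invQPoch, if_neg]
    omega
  simp only [summand, ← hc, hz, mul_zero, zero_mul]

end

end HallLittlewood

/-! Both sides equal `q^(r²-r) * baileySum ψ (hlAlpha q N) r` with `N = 2n + δ` and `ψ m =
1/(q;q)_m`.

For the left side, `P_{(2^r)}` is a sum over the `r`-subsets of the variables (`ratP_twoOn`). A
Lagrange interpolation identity gives a recursion in `r`, from which this sum is expanded in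
products `e_{r-j} e_{r+j}` (`subsetSum_eq_twoColSum`). The expansion has no denominators and is
stable in the number of variables. At `x_i = q^(i-1)` the polynomials `e_a` tend `q`-adically to
`q^(a(a-1)/2)/(q;q)_a`, and the expansion becomes the Bailey sum (`IsInvPoch.twoColSum_eq`).

For the right side, summing over one variable `r_i` is one application of the Bailey lemma at `a =
q`, which multiplies `α_k` by `q^(k²+k)` and so raises `N` by 2
(`IsInvPoch.baileySum_hlAlpha_add_two`). The chain starts at `N = 0`, where the sum is
`1/(q²;q²)_r`, or at `N = 1`, where it is `1/(q;q)_r`; this accounts for the two values of `δ`. -/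

namespace HallLittlewood

/-! ### Elementary symmetric polynomials over finite sets. -/

section Elementary

variable {ι R : Type*} [CommSemiring R]

/-- The elementary symmetric polynomial of degree `a` in the variables `x i`, `i ∈ s`. -/
def elemSym (x : ι → R) (s : Finset ι) (a : ℕ) : R := ∑ A ∈ s.powersetCard a, ∏ i ∈ A, x i

theorem elemSym_zero (x : ι → R) (s : Finset ι) : elemSym x s 0 = 1 := by
  simp [elemSym]

theorem elemSym_eq_zero (x : ι → R) {s : Finset ι} {a : ℕ} (h : s.card < a) :
    elemSym x s a = 0 := by
  rw [elemSym, Finset.powersetCard_eq_empty.mpr h, Finset.sum_empty]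

theorem elemSym_card (x : ι → R) (s : Finset ι) : elemSym x s s.card = ∏ i ∈ s, x i := by
  rw [elemSym, Finset.powersetCard_self, Finset.sum_singleton]

theorem elemSym_insert [DecidableEq ι] (x : ι → R) {s : Finset ι} {i : ι} (hi : i ∉ s) (a : ℕ) :
    elemSym x (insert i s) (a + 1) = elemSym x s (a + 1) + x i * elemSym x s a := by
  have hmem : ∀ A ∈ s.powersetCard a, i ∉ A := fun A hA h =>
    hi ((Finset.mem_powersetCard.mp hA).1 h)
  rw [elemSym, Finset.powersetCard_succ_insert hi, Finset.sum_union, Finset.sum_image,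
    elemSym, elemSym, Finset.mul_sum]
  · congr 1
    exact Finset.sum_congr rfl fun A hA => Finset.prod_insert (hmem A hA)
  · intro A hA B hB h
    rw [← Finset.erase_insert (hmem A hA), ← Finset.erase_insert (hmem B hB)]
    exact congrArg (Finset.erase · i) h
  · refine Finset.disjoint_left.mpr fun A hA hA' => ?_
    obtain ⟨B, -, rfl⟩ := Finset.mem_image.mp hA'
    exact hi ((Finset.mem_powersetCard.mp hA).1 (Finset.mem_insert_self i B))

theorem elemSym_erase [DecidableEq ι] (x : ι → R) {s : Finset ι} {i : ι} (hi : i ∈ s) (a : ℕ) :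
    elemSym x s (a + 1) = elemSym x (s.erase i) (a + 1) + x i * elemSym x (s.erase i) a := by
  conv_lhs => rw [← Finset.insert_erase hi]
  exact elemSym_insert x (Finset.notMem_erase i s) a

theorem elemSym_mul_left (c : R) (x : ι → R) (s : Finset ι) (a : ℕ) :
    elemSym (fun i => c * x i) s a = c ^ a * elemSym x s a := by
  rw [elemSym, elemSym, Finset.mul_sum]
  refine Finset.sum_congr rfl fun A hA => ?_
  rw [Finset.prod_mul_distrib, Finset.prod_const, (Finset.mem_powersetCard.mp hA).2]

theorem coeff_prod_X_add_C (x : ι → R) (s : Finset ι) {a b : ℕ} (h : a + b = s.card) :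
    (∏ i ∈ s, (Polynomial.X + Polynomial.C (x i))).coeff a = elemSym x s b := by
  rw [Finset.prod_X_add_C_coeff s x (by omega), elemSym]
  congr 2
  omega

theorem map_elemSym {S : Type*} [CommSemiring S] (f : R →+* S) (x : ι → R) (s : Finset ι)
    (a : ℕ) : f (elemSym x s a) = elemSym (fun i => f (x i)) s a := by
  simp [elemSym]

end Elementary

/-! ### The two-column expansion. -/

section TwoColumns

variable {R : Type*} [CommRing R]

/-- The product `e_{r-j} e_{r+j}`, which is zero for `j > r`. -/
def elemProd (e : ℕ → R) (r j : ℕ) : R := if j ≤ r then e (r - j) * e (r + j) else 0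

/-- The expansion `∑_j (-1)^j t^(j(j+1)/2) (e_{r-j} e_{r+j} - e_{r-j-1} e_{r+j+1})` of the
Hall–Littlewood polynomial `P_{(2^r)}` in terms of elementary symmetric polynomials. -/
def twoColSum (e : ℕ → R) (t : R) (r : ℕ) : R :=
  ∑ j ∈ Finset.range (r + 1),
    (-1) ^ j * t ^ (j + 1).choose 2 * (elemProd e r j - elemProd e r (j + 1))

theorem map_twoColSum {S : Type*} [CommRing S] (f : R →+* S) (e : ℕ → R) (t : R) (r : ℕ) :
    f (twoColSum e t r) = twoColSum (fun a => f (e a)) (f t) r := by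
  have h : ∀ j, f (elemProd e r j) = elemProd (fun a => f (e a)) r j := fun j => by
    rw [elemProd, elemProd]
    split_ifs
    · rw [map_mul]
    · exact map_zero f
  simp [twoColSum, h]

end TwoColumns

/-! ### From the sum over subsets to the two-column expansion, over a field. -/

section Field

variable {ι K : Type*} [DecidableEq ι] [Field K]

/-- The product `∏_{j ∈ s, j ≠ i} (x_i - t x_j) / (x_i - x_j)`. -/
def hlWeight (x : ι → K) (t : K) (s : Finset ι) (i : ι) : K :=
  ∏ j ∈ s.erase i, (x i - t * x j) / (x i - x j)

/-- Lagrange interpolation: both sides have degree below `s.card`, since the leading terms on the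
right cancel, and they agree at the `s.card` points `-x i`, where a single summand on the left
survives. -/
theorem sum_hlWeight_mul_prod {x : ι → K} (t : K) {s : Finset ι} (hx : Set.InjOn x s) :
    ∑ i ∈ s, Polynomial.C ((1 - t) * (x i * hlWeight x t s i)) *
        ∏ j ∈ s.erase i, (Polynomial.X + Polynomial.C (x j)) =
      ∏ j ∈ s, (Polynomial.X + Polynomial.C (x j)) -
        ∏ j ∈ s, (Polynomial.X + Polynomial.C (t * x j)) := by
  rcases s.eq_empty_or_nonempty with rfl | hs
  · simp
  have hinj : Set.InjOn (fun i => -x i) s := fun a ha b hb h => hx ha hb (neg_injective h)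
  refine Polynomial.eq_of_degrees_lt_of_eval_index_eq s hinj ?_ ?_ fun i hi => ?_
  · refine (Polynomial.degree_sum_le _ _).trans_lt ?_
    rw [Finset.sup_lt_iff (WithBot.bot_lt_coe _)]
    intro i hi
    rw [← Polynomial.smul_eq_C_mul]
    refine (Polynomial.degree_smul_le _ _).trans_lt ?_
    rw [Polynomial.degree_prod]
    simp only [Polynomial.degree_X_add_C, Finset.sum_const, Finset.card_erase_of_mem hi]
    have := Finset.card_pos.mpr hs
    rw [nsmul_one]
    exact_mod_cast (by omega : s.card - 1 < s.card)
  · have hd : ∀ y : ι → K, (∏ j ∈ s, (Polynomial.X + Polynomial.C (y j))).degree = (s.card : WithBot ℕ) := by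
      intro y
      rw [Polynomial.degree_prod]
      simp
    have hm : ∀ y : ι → K, (∏ j ∈ s, (Polynomial.X + Polynomial.C (y j))).Monic := fun y =>
      Polynomial.monic_prod_of_monic _ _ fun i _ => Polynomial.monic_X_add_C _
    refine (Polynomial.degree_sub_lt_left ?_ (hm _).ne_zero ?_).trans_eq (hd x)
    · rw [hd, hd]
    · rw [(hm _).leadingCoeff, (hm _).leadingCoeff]
  · have hzero : ∏ j ∈ s, (-x i + x j) = 0 := Finset.prod_eq_zero hi (neg_add_cancel _)
    simp only [Polynomial.eval_finsetSum, Polynomial.eval_sub, Polynomial.eval_mul,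
      Polynomial.eval_C, Polynomial.eval_prod, Polynomial.eval_add, Polynomial.eval_X, hzero,
      zero_sub]
    rw [Finset.sum_eq_single_of_mem i hi, ← Finset.mul_prod_erase s _ hi, hlWeight]
    · have key : (∏ j ∈ s.erase i, (x i - t * x j) / (x i - x j)) *
          ∏ j ∈ s.erase i, (-x i + x j) = ∏ j ∈ s.erase i, (-x i + t * x j) := by
        rw [← Finset.prod_mul_distrib]
        refine Finset.prod_congr rfl fun j hj => ?_
        have hne : x i - x j ≠ 0 := sub_ne_zero_of_ne fun h =>
          Finset.ne_of_mem_erase hj (hx (Finset.mem_of_mem_erase hj) hi h.symm)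
        field_simp
        ring
      rw [← key]
      ring
    · intro l hl hli
      rw [Finset.prod_eq_zero (Finset.mem_erase.mpr ⟨hli.symm, hi⟩) (neg_add_cancel _), mul_zero]

/-- Compare coefficients of `X ^ a` in `sum_hlWeight_mul_prod`, where `a + b + 1 = s.card`; for
larger `b` both sides vanish. -/
theorem sum_hlWeight_mul_elemSym {x : ι → K} (t : K) {s : Finset ι} (hx : Set.InjOn x s) (b : ℕ) :
    (1 - t) * ∑ i ∈ s, x i * hlWeight x t s i * elemSym x (s.erase i) b =
      (1 - t ^ (b + 1)) * elemSym x s (b + 1) := by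
  by_cases hb : b + 1 ≤ s.card
  · obtain ⟨a, ha⟩ := Nat.exists_eq_add_of_le' hb
    have h := congrArg (Polynomial.coeff · a) (sum_hlWeight_mul_prod t hx)
    simp only [Polynomial.finsetSum_coeff, Polynomial.coeff_sub, Polynomial.coeff_C_mul] at h
    rw [coeff_prod_X_add_C _ s ha.symm, coeff_prod_X_add_C _ s ha.symm, elemSym_mul_left] at h
    rw [one_sub_mul (t ^ (b + 1)), ← h, Finset.mul_sum]
    refine Finset.sum_congr rfl fun i hi => ?_
    rw [coeff_prod_X_add_C x (s.erase i) (b := b), ← mul_assoc]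
    rw [Finset.card_erase_of_mem hi]
    omega
  · rw [elemSym_eq_zero x (by omega), mul_zero, Finset.sum_eq_zero, mul_zero]
    intro i hi
    rw [elemSym_eq_zero x, mul_zero]
    have := Finset.card_pos.mpr ⟨i, hi⟩
    rw [Finset.card_erase_of_mem hi]
    omega

/-- The case `b = s.card - 1` of the previous identity: each summand then contains the full product
of the `x i`, which is cancelled. -/
theorem sum_hlWeight {x : ι → K} (t : K) {s : Finset ι} (hx : Set.InjOn x s)
    (h0 : ∀ i ∈ s, x i ≠ 0) : (1 - t) * ∑ i ∈ s, hlWeight x t s i = 1 - t ^ s.card := by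
  rcases s.eq_empty_or_nonempty with rfl | hs
  · simp
  have hc : s.card - 1 + 1 = s.card := Nat.sub_add_cancel (Finset.card_pos.mpr hs)
  have h := sum_hlWeight_mul_elemSym t hx (s.card - 1)
  rw [hc, elemSym_card] at h
  refine mul_right_cancel₀ (Finset.prod_ne_zero_iff.mpr h0) ?_
  rw [← h, mul_assoc, Finset.sum_mul]
  congr 1
  refine Finset.sum_congr rfl fun i hi => ?_
  rw [← Finset.card_erase_of_mem hi, elemSym_card, ← Finset.mul_prod_erase s _ hi]
  ring

/-- The Hall–Littlewood polynomial `P_{(2^r)}` as a sum over subsets of cardinality `r`. -/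
def subsetSum (x : ι → K) (t : K) (s : Finset ι) (r : ℕ) : K :=
  ∑ I ∈ s.powersetCard r, (∏ i ∈ I, x i ^ 2) *
    ∏ i ∈ I, ∏ j ∈ s \ I, (x i - t * x j) / (x i - x j)

/-- In the term of `I`, write `1 - t ^ (r + 1)` as a sum over `i ∈ I` by `sum_hlWeight`. The factors
pairing `i` with `I \ {i}` and with `s \ I` combine to the weight of `i` in `s`; what remains is the
term of `I \ {i}` in `s \ {i}`. -/
theorem subsetSum_succ {x : ι → K} (t : K) {s : Finset ι} (hx : Set.InjOn x s)
    (h0 : ∀ i ∈ s, x i ≠ 0) (r : ℕ) :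
    (1 - t ^ (r + 1)) * subsetSum x t s (r + 1) =
      (1 - t) * ∑ i ∈ s, x i ^ 2 * hlWeight x t s i * subsetSum x t (s.erase i) r := by
  have hl : ∀ I ∈ s.powersetCard (r + 1), (1 - t ^ (r + 1)) * ((∏ i ∈ I, x i ^ 2) *
      ∏ i ∈ I, ∏ j ∈ s \ I, (x i - t * x j) / (x i - x j)) =
      ∑ i ∈ I, (1 - t) * (hlWeight x t I i * ((∏ i ∈ I, x i ^ 2) *
      ∏ i ∈ I, ∏ j ∈ s \ I, (x i - t * x j) / (x i - x j))) := by
    intro I hI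
    obtain ⟨hIs, hIc⟩ := Finset.mem_powersetCard.mp hI
    rw [← Finset.mul_sum, ← Finset.sum_mul, ← mul_assoc (1 - t),
      sum_hlWeight t (hx.mono (Finset.coe_subset.mpr hIs)) fun i hi => h0 i (hIs hi), hIc]
  simp only [subsetSum]
  rw [Finset.mul_sum, Finset.sum_congr rfl hl, Finset.mul_sum]
  simp only [Finset.mul_sum]
  rw [Finset.sum_sigma', Finset.sum_sigma']
  refine Finset.sum_bij' (fun a _ => ⟨a.2, a.1.erase a.2⟩) (fun a _ => ⟨insert a.1 a.2, a.1⟩)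
    ?_ ?_ ?_ ?_ ?_
  · rintro ⟨I, i⟩ h
    simp only [Finset.mem_sigma, Finset.mem_powersetCard] at h ⊢
    refine ⟨h.1.1 h.2, Finset.erase_subset_erase _ h.1.1, ?_⟩
    rw [Finset.card_erase_of_mem h.2, h.1.2, Nat.add_sub_cancel]
  · rintro ⟨i, J⟩ h
    simp only [Finset.mem_sigma, Finset.mem_powersetCard] at h ⊢
    have hiJ : i ∉ J := fun hi => Finset.notMem_erase i s (h.2.1 hi)
    refine ⟨⟨Finset.insert_subset h.1 (h.2.1.trans (Finset.erase_subset _ _)), ?_⟩,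
      Finset.mem_insert_self _ _⟩
    rw [Finset.card_insert_of_notMem hiJ, h.2.2]
  · rintro ⟨I, i⟩ h
    simp only [Finset.mem_sigma] at h
    simp [Finset.insert_erase h.2]
  · rintro ⟨i, J⟩ h
    simp only [Finset.mem_sigma, Finset.mem_powersetCard] at h
    have hiJ : i ∉ J := fun hi => Finset.notMem_erase i s (h.2.1 hi)
    simp [Finset.erase_insert hiJ]
  · rintro ⟨I, i⟩ h
    simp only [Finset.mem_sigma, Finset.mem_powersetCard] at h ⊢
    obtain ⟨⟨hIs, -⟩, hi⟩ := h
    have hsd : s.erase i \ I.erase i = s \ I := by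
      ext j
      simp only [Finset.mem_sdiff, Finset.mem_erase]
      grind
    have hw : hlWeight x t s i =
        hlWeight x t I i * ∏ j ∈ s \ I, (x i - t * x j) / (x i - x j) := by
      rw [hlWeight, hlWeight, mul_comm, ← hsd]
      exact (Finset.prod_sdiff (Finset.erase_subset_erase i hIs)).symm
    rw [hsd, hw, ← Finset.mul_prod_erase I _ hi, ← Finset.mul_prod_erase I _ hi]
    ring

/-- On the right, one factor of each product absorbs its power of `t` by `sum_hlWeight_mul_elemSym`;
the other is split according to whether `i` occurs. The terms free of the extra `x i` cancel, which
is why differences of consecutive products are the right objects. -/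
theorem sum_hlWeight_elemProd_sub {x : ι → K} (t : K) {s : Finset ι} (hx : Set.InjOn x s)
    {r j : ℕ} (hj : j ≤ r) :
    (1 - t) * ∑ i ∈ s, x i ^ 2 * hlWeight x t s i *
        (elemProd (elemSym x (s.erase i)) r j - elemProd (elemSym x (s.erase i)) r (j + 1)) =
      (1 - t ^ (r + 1 - j)) * elemProd (elemSym x s) (r + 1) j -
        (1 - t ^ (r + 1 + (j + 1))) * elemProd (elemSym x s) (r + 1) (j + 1) := by
  obtain ⟨a, rfl⟩ := Nat.exists_eq_add_of_le' hj
  have e1 : elemProd (elemSym x s) (a + j + 1) j = elemSym x s (a + 1) * elemSym x s (a + 2 * j + 1) := by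
    rw [elemProd, if_pos (by omega)]
    congr 2 <;> omega
  have e2 : elemProd (elemSym x s) (a + j + 1) (j + 1) = elemSym x s a * elemSym x s (a + 2 * j + 2) := by
    rw [elemProd, if_pos (by omega)]
    congr 2 <;> omega
  rw [e1, e2, show a + j + 1 - j = a + 1 by omega,
    show a + j + 1 + (j + 1) = a + 2 * j + 1 + 1 by omega, ← mul_assoc,
    ← sum_hlWeight_mul_elemSym t hx, mul_left_comm _ (elemSym x s a),
    ← sum_hlWeight_mul_elemSym t hx, mul_left_comm _ (1 - t), mul_assoc, ← mul_sub]
  congr 1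
  rw [Finset.sum_mul, Finset.mul_sum, ← Finset.sum_sub_distrib]
  refine Finset.sum_congr rfl fun i hi => ?_
  have e3 : elemProd (elemSym x (s.erase i)) (a + j) j =
      elemSym x (s.erase i) a * elemSym x (s.erase i) (a + 2 * j) := by
    rw [elemProd, if_pos (by omega)]
    congr 2 <;> omega
  rw [e3, elemSym_erase x hi (a + 2 * j)]
  rcases a with _ | a
  · rw [elemProd, if_neg (by omega), elemSym_zero, elemSym_zero]
    ring
  · have e4 : elemProd (elemSym x (s.erase i)) (a + 1 + j) (j + 1) =
        elemSym x (s.erase i) a * elemSym x (s.erase i) (a + 1 + 2 * j + 1) := by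
      rw [elemProd, if_pos (by omega)]
      congr 2 <;> omega
    rw [e4, elemSym_erase x hi a]
    ring

/-- Induction on `r`: the recursion of `subsetSum_succ` acts on the expansion termwise, and the
result differs from `1 - t ^ (r + 1)` times the next expansion by a telescoping sum. -/
theorem subsetSum_eq_twoColSum {x : ι → K} {t : K} (ht : ∀ m : ℕ, t ^ (m + 1) ≠ 1) (r : ℕ) :
    ∀ {s : Finset ι}, Set.InjOn x s → (∀ i ∈ s, x i ≠ 0) →
      subsetSum x t s r = twoColSum (elemSym x s) t r := by
  induction r with
  | zero =>
    intro s _ _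
    simp [subsetSum, twoColSum, elemProd, elemSym_zero]
  | succ r ih =>
    intro s hx h0
    have hne : 1 - t ^ (r + 1) ≠ 0 := sub_ne_zero_of_ne (ht r).symm
    refine mul_left_cancel₀ hne ?_
    have hs : ∀ i ∈ s, subsetSum x t (s.erase i) r = twoColSum (elemSym x (s.erase i)) t r := fun i _ =>
      ih (hx.mono (Finset.coe_subset.mpr (Finset.erase_subset i s)))
        fun j hj => h0 j (Finset.mem_of_mem_erase hj)
    have h1 : (1 - t ^ (r + 1)) * subsetSum x t s (r + 1) =
        ∑ j ∈ Finset.range (r + 1), (-1) ^ j * t ^ (j + 1).choose 2 *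
          ((1 - t ^ (r + 1 - j)) * elemProd (elemSym x s) (r + 1) j -
            (1 - t ^ (r + 1 + (j + 1))) * elemProd (elemSym x s) (r + 1) (j + 1)) := by
      rw [subsetSum_succ t hx h0, Finset.sum_congr rfl fun i hi => by rw [hs i hi]]
      simp only [twoColSum, Finset.mul_sum]
      rw [Finset.sum_comm]
      refine Finset.sum_congr rfl fun j hj => ?_
      rw [← sum_hlWeight_elemProd_sub t hx (Nat.lt_succ_iff.mp (Finset.mem_range.mp hj)),
        Finset.mul_sum, Finset.mul_sum]
      refine Finset.sum_congr rfl fun i _ => ?_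
      ring
    -- The telescoping discrepancy: `u 0 = 0`, and `u (r + 1)` is the extra last term `j = r + 1` of
    -- the expansion for `r + 1`.
    set u : ℕ → K := fun j => (-1) ^ j * t ^ (j + 1).choose 2 * (t ^ (r + 1 - j) - t ^ (r + 1)) *
      elemProd (elemSym x s) (r + 1) j with hu
    have h2 : ∀ j ∈ Finset.range (r + 1), (1 - t ^ (r + 1)) * ((-1) ^ j * t ^ (j + 1).choose 2 *
        (elemProd (elemSym x s) (r + 1) j - elemProd (elemSym x s) (r + 1) (j + 1))) =
        (-1) ^ j * t ^ (j + 1).choose 2 * ((1 - t ^ (r + 1 - j)) * elemProd (elemSym x s) (r + 1) j -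
            (1 - t ^ (r + 1 + (j + 1))) * elemProd (elemSym x s) (r + 1) (j + 1)) + (u j - u (j + 1)) := by
      intro j hj
      obtain ⟨a, ha⟩ := Nat.exists_eq_add_of_le' (Nat.lt_succ_iff.mp (Finset.mem_range.mp hj))
      subst ha
      have hc : (j + 1 + 1).choose 2 = (j + 1).choose 2 + (j + 1) := by
        rw [Nat.choose_succ_succ, Nat.choose_one_right, add_comm]
      simp only [hu, hc, show a + j + 1 - j = a + 1 by omega,
        show a + j + 1 - (j + 1) = a by omega]
      ring
    rw [h1, twoColSum, Finset.sum_range_succ _ (r + 1), mul_add, Finset.mul_sum, Finset.sum_congr rfl h2,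
      Finset.sum_add_distrib, Finset.sum_range_sub']
    have hlast : elemProd (elemSym x s) (r + 1) (r + 1 + 1) = 0 := by rw [elemProd, if_neg (by omega)]
    simp only [hu, hlast]
    simp
    ring

end Field

end HallLittlewood

namespace HallLittlewood

/-! ### The Bailey lemma and the Bailey pairs needed. -/

section Bailey

variable {R : Type*} [CommRing R]

/-- `ψ m = 1 / (q; q)_m`, expressed by the recurrence. -/
structure IsInvPoch (q : R) (ψ : ℕ → R) : Prop where
  zero : ψ 0 = 1
  succ : ∀ m, ψ m = (1 - q ^ (m + 1)) * ψ (m + 1)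

variable {q : R} {ψ : ℕ → R}

/-- The Durfee rectangle identity (a limit of the `q`-Chu–Vandermonde sum). -/
theorem IsInvPoch.durfee [IsDomain R] (h : IsInvPoch q ψ) (hq : ∀ m : ℕ, q ^ (m + 1) ≠ 1) (m : ℕ) :
    ∀ a, ∑ i ∈ Finset.range (m + 1), q ^ (i * (i + a)) * (ψ (m - i) * ψ i * ψ (i + a)) =
      ψ m * ψ (m + a) := by
  induction m with
  | zero => intro a; simp [h.zero]
  | succ m ih =>
    intro a
    refine mul_left_cancel₀ (sub_ne_zero_of_ne (hq m).symm) ?_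
    -- Splitting `1 - q^(m+1) = (1 - q^(m+1-i)) + q^(m+1-i) (1 - q^i)`: the first part reduces to
    -- `(m, a)`, the second, after shifting `i`, to `(m, a + 1)`.
    have hsplit : ∀ i ∈ Finset.range (m + 1 + 1), (1 - q ^ (m + 1)) *
        (q ^ (i * (i + a)) * (ψ (m + 1 - i) * ψ i * ψ (i + a))) =
        (1 - q ^ (m + 1 - i)) * (q ^ (i * (i + a)) * (ψ (m + 1 - i) * ψ i * ψ (i + a))) +
        q ^ (m + 1 - i) * (1 - q ^ i) *
          (q ^ (i * (i + a)) * (ψ (m + 1 - i) * ψ i * ψ (i + a))) := by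
      intro i hi
      obtain ⟨b, hb⟩ := Nat.exists_eq_add_of_le' (Nat.lt_succ_iff.mp (Finset.mem_range.mp hi))
      rw [hb, Nat.add_sub_cancel]
      ring
    have h1 : ∑ i ∈ Finset.range (m + 1 + 1),
        (1 - q ^ (m + 1 - i)) * (q ^ (i * (i + a)) * (ψ (m + 1 - i) * ψ i * ψ (i + a))) =
        ψ m * ψ (m + a) := by
      rw [Finset.sum_range_succ, ← ih a]
      simp only [Nat.sub_self, pow_zero, sub_self, zero_mul, add_zero]
      refine Finset.sum_congr rfl fun i hi => ?_
      have hi' : m + 1 - i = m - i + 1 := by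
        have := Finset.mem_range.mp hi
        omega
      rw [hi', h.succ (m - i)]
      ring
    have h2 : ∑ i ∈ Finset.range (m + 1 + 1), q ^ (m + 1 - i) * (1 - q ^ i) *
          (q ^ (i * (i + a)) * (ψ (m + 1 - i) * ψ i * ψ (i + a))) =
        q ^ (m + 1 + a) * (ψ m * ψ (m + (a + 1))) := by
      rw [Finset.sum_range_succ', ← ih (a + 1), Finset.mul_sum]
      simp only [pow_zero, sub_self, mul_zero, zero_mul, add_zero]
      refine Finset.sum_congr rfl fun i hi => ?_
      obtain ⟨b, hb⟩ := Nat.exists_eq_add_of_le' (Nat.lt_succ_iff.mp (Finset.mem_range.mp hi))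
      subst hb
      rw [h.succ i, show b + i + 1 - (i + 1) = b by omega, show b + i - i = b by omega,
        show i + 1 + a = i + (a + 1) by omega]
      ring
    rw [Finset.mul_sum, Finset.sum_congr rfl hsplit, Finset.sum_add_distrib, h1, h2,
      h.succ (m + a), h.succ m, show m + a + 1 = m + 1 + a by omega,
      show m + (a + 1) = m + 1 + a by omega]
    ring

/-- The side `β_r = ∑_k α_k / ((q; q)_{r-k} (q; q)_{r+k+1})` of a Bailey pair. -/
def baileySum (ψ : ℕ → R) (α : ℕ → R) (r : ℕ) : R :=
  ∑ k ∈ Finset.range (r + 1), α k * (ψ (r - k) * ψ (r + k + 1))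

/-- The Bailey lemma for `a = q`. -/
theorem IsInvPoch.bailey [IsDomain R] (h : IsInvPoch q ψ) (hq : ∀ m : ℕ, q ^ (m + 1) ≠ 1)
    (α : ℕ → R) (r : ℕ) :
    ∑ s ∈ Finset.range (r + 1), q ^ (s ^ 2 + s) * ψ (r - s) * baileySum ψ α s =
      baileySum ψ (fun k => q ^ (k ^ 2 + k) * α k) r := by
  simp only [baileySum, Finset.mul_sum]
  have hcomm : ∀ s k, s ∈ Finset.range (r + 1) ∧ k ∈ Finset.range (s + 1) ↔
      s ∈ Finset.Ico k (r + 1) ∧ k ∈ Finset.range (r + 1) := by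
    intro s k
    simp only [Finset.mem_range, Finset.mem_Ico]
    omega
  rw [Finset.sum_comm' hcomm]
  refine Finset.sum_congr rfl fun k hk => ?_
  obtain ⟨b, hb⟩ := Nat.exists_eq_add_of_le (Nat.lt_succ_iff.mp (Finset.mem_range.mp hk))
  subst hb
  -- With `s = k + i`, the inner sum is the Durfee identity for `m = r - k` and `a = 2k + 1`.
  have hd := h.durfee hq b (2 * k + 1)
  rw [Finset.sum_Ico_eq_sum_range, show k + b + 1 - k = b + 1 by omega,
    show k + b - k = b by omega, show k + b + k + 1 = b + (2 * k + 1) by omega, ← hd,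
    Finset.mul_sum]
  refine Finset.sum_congr rfl fun i hi => ?_
  obtain ⟨c, hc⟩ := Nat.exists_eq_add_of_le (Nat.lt_succ_iff.mp (Finset.mem_range.mp hi))
  subst hc
  rw [show k + (i + c) - (k + i) = c by omega, show k + i - k = i by omega,
    show i + c - i = c by omega, show k + i + k + 1 = i + (2 * k + 1) by omega]
  ring

/-- The sequence `(-1)^k q^(N k(k+1)/2 + k²) (1 - q^(2k+1))`. -/
def hlAlpha (q : R) (N k : ℕ) : R :=
  (-1) ^ k * q ^ (N * (k + 1).choose 2 + k ^ 2) * (1 - q ^ (2 * k + 1))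

theorem two_mul_choose_two (k : ℕ) : 2 * (k + 1).choose 2 = k ^ 2 + k := by
  have h' := Nat.div_mul_cancel (Nat.even_mul_succ_self k).two_dvd
  rw [Nat.choose_two_right, Nat.add_sub_cancel, mul_comm (k + 1)]
  rw [mul_comm 2, h']
  ring

/-- Since `2 * (k + 1).choose 2 = k² + k`, raising `N` by 2 multiplies `α_k` by exactly the Bailey
lemma's factor. -/
theorem IsInvPoch.baileySum_hlAlpha_add_two [IsDomain R] (h : IsInvPoch q ψ)
    (hq : ∀ m : ℕ, q ^ (m + 1) ≠ 1) (N r : ℕ) :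
    baileySum ψ (hlAlpha q (N + 2)) r =
      ∑ s ∈ Finset.range (r + 1), q ^ (s ^ 2 + s) * ψ (r - s) * baileySum ψ (hlAlpha q N) s := by
  rw [h.bailey hq]
  congr 1
  funext k
  rw [hlAlpha, hlAlpha, add_mul N 2, two_mul_choose_two]
  ring

/-- This is the recurrence of `1/(q²;q²)_r`, proved by telescoping. -/
theorem IsInvPoch.baileySum_hlAlpha_zero_succ (h : IsInvPoch q ψ) (r : ℕ) :
    (1 - q ^ (2 * (r + 1))) * baileySum ψ (hlAlpha q 0) (r + 1) =
      baileySum ψ (hlAlpha q 0) r := by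
  -- Closed form of the partial sums of the difference; at `K = r` it cancels the term `k = r + 1`,
  -- which occurs only in the sum for `r + 1`.
  have key : ∀ K ≤ r, ∑ k ∈ Finset.range (K + 1), ((1 - q ^ (2 * (r + 1))) *
        (hlAlpha q 0 k * (ψ (r + 1 - k) * ψ (r + 1 + k + 1))) -
        hlAlpha q 0 k * (ψ (r - k) * ψ (r + k + 1))) =
      (-1) ^ K * q ^ (r + 1 + K ^ 2 + K) * (1 - q ^ (2 * K + 2)) *
        (ψ (r - K) * ψ (r + 1 + K + 1)) := by
    intro K
    induction K with
    | zero =>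
      intro _
      rw [Finset.sum_range_one, Nat.sub_zero, Nat.sub_zero, h.succ r, h.succ (r + 0 + 1), hlAlpha,
        show r + 0 + 1 + 1 = r + 1 + 0 + 1 by omega]
      ring
    | succ K ih =>
      intro hK
      obtain ⟨b, rfl⟩ := Nat.exists_eq_add_of_le' hK
      rw [Finset.sum_range_succ, ih (by omega), show b + (K + 1) - K = b + 1 by omega,
        show b + (K + 1) - (K + 1) = b by omega, show b + (K + 1) + 1 - (K + 1) = b + 1 by omega,
        h.succ b, h.succ (b + (K + 1) + (K + 1) + 1), h.succ (b + (K + 1) + 1 + K + 1), hlAlpha,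
        show b + (K + 1) + 1 + K + 1 + 1 = b + (K + 1) + 1 + (K + 1) + 1 by omega,
        show b + (K + 1) + (K + 1) + 1 + 1 = b + (K + 1) + 1 + (K + 1) + 1 by omega]
      ring
  have hr := key r le_rfl
  rw [Finset.sum_sub_distrib, ← Finset.mul_sum, Nat.sub_self] at hr
  rw [baileySum, Finset.sum_range_succ, mul_add, Nat.sub_self]
  change _ = ∑ k ∈ Finset.range (r + 1), _
  rw [← sub_eq_zero, add_sub_right_comm, hr, hlAlpha, h.succ (r + 1 + r + 1),
    show r + 1 + r + 1 + 1 = r + 1 + (r + 1) + 1 by omega]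
  ring

theorem IsInvPoch.baileySum_zero (h : IsInvPoch q ψ) (N : ℕ) : baileySum ψ (hlAlpha q N) 0 = 1 := by
  have h1 := h.succ 0
  rw [h.zero] at h1
  simp [baileySum, hlAlpha, h.zero] at h1 ⊢
  exact h1.symm

/-- The unit Bailey pair. -/
theorem IsInvPoch.baileySum_unit [IsDomain R] (h : IsInvPoch q ψ) (hq : ∀ m : ℕ, q ^ (m + 1) ≠ 1)
    (r : ℕ) :
    baileySum ψ (fun k => (-1) ^ k * q ^ k.choose 2 * (1 - q ^ (2 * k + 1))) r =
      if r = 0 then 1 else 0 := by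
  rcases r with _ | r
  · have h1 := h.succ 0
    rw [h.zero] at h1
    simp [baileySum, h.zero] at h1 ⊢
    exact h1.symm
  rw [if_neg r.succ_ne_zero]
  refine mul_left_cancel₀ (sub_ne_zero_of_ne (hq r).symm) ?_
  -- Closed form of the partial sums; at `K = r` it is the negative of the remaining term `k = r +
  -- 1`, up to the common factor.
  have key : ∀ K ≤ r, (1 - q ^ (r + 1)) * ∑ k ∈ Finset.range (K + 1),
        (-1) ^ k * q ^ k.choose 2 * (1 - q ^ (2 * k + 1)) *
          (ψ (r + 1 - k) * ψ (r + 1 + k + 1)) =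
      (-1) ^ K * q ^ (K + 1).choose 2 * (1 - q ^ (K + 1)) * (ψ (r - K) * ψ (r + 1 + K + 1)) := by
    intro K
    induction K with
    | zero =>
      intro _
      rw [Finset.sum_range_one, Nat.sub_zero, Nat.sub_zero, h.succ r]
      simp
      ring
    | succ K ih =>
      intro hK
      obtain ⟨b, rfl⟩ := Nat.exists_eq_add_of_le' hK
      have hc : (K + 1 + 1).choose 2 = (K + 1).choose 2 + (K + 1) := by
        rw [Nat.choose_succ_succ, Nat.choose_one_right, add_comm]
      rw [Finset.sum_range_succ, mul_add, ih (by omega), hc,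
        show b + (K + 1) - K = b + 1 by omega, show b + (K + 1) - (K + 1) = b by omega,
        show b + (K + 1) + 1 - (K + 1) = b + 1 by omega, h.succ b,
        h.succ (b + (K + 1) + 1 + K + 1),
        show b + (K + 1) + 1 + K + 1 + 1 = b + (K + 1) + 1 + (K + 1) + 1 by omega]
      ring
  rw [baileySum, Finset.sum_range_succ, mul_add, key r le_rfl]
  have hc : (r + 1 + 1).choose 2 = (r + 1).choose 2 + (r + 1) := by
    rw [Nat.choose_succ_succ, Nat.choose_one_right, add_comm]
  simp only [Nat.sub_self]
  rw [h.succ (r + 1 + r + 1), show r + 1 + r + 1 + 1 = r + 1 + (r + 1) + 1 by omega]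
  ring

/-- One Bailey step applied to the unit pair, of which only `s = 0` survives. -/
theorem IsInvPoch.baileySum_hlAlpha_one [IsDomain R] (h : IsInvPoch q ψ)
    (hq : ∀ m : ℕ, q ^ (m + 1) ≠ 1) (r : ℕ) : baileySum ψ (hlAlpha q 1) r = ψ r := by
  have hα : hlAlpha q 1 =
      fun k => q ^ (k ^ 2 + k) * ((-1) ^ k * q ^ k.choose 2 * (1 - q ^ (2 * k + 1))) := by
    funext k
    have hc : (k + 1).choose 2 = k.choose 2 + k := by
      rw [Nat.choose_succ_succ, Nat.choose_one_right, add_comm]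
    rw [hlAlpha, hc]
    ring
  rw [hα, ← h.bailey hq, Finset.sum_range_succ']
  simp [h.baileySum_unit hq]

end Bailey

end HallLittlewood

/-! ### `P_{(2^r)}` as a polynomial and as a symmetric function. -/

namespace HallLittlewood

/-- The indicator sequence with value `2` on `J` and `0` elsewhere. -/
def twoOn {k : ℕ} (J : Finset (Fin k)) (i : Fin k) : ℕ := if i ∈ J then 2 else 0

/-- The pairs with `λ_i > λ_j` are those in `J × Jᶜ`, so the summand depends on `w` only through the
image of `J`. -/
theorem term_twoOn {k : ℕ} (J : Finset (Fin k)) (w : Equiv.Perm (Fin k)) :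
    term (twoOn J) w = (∏ i ∈ J.map w.toEmbedding, x i ^ 2) *
      ∏ i ∈ J.map w.toEmbedding, ∏ j ∈ Finset.univ \ J.map w.toEmbedding,
        (x i - t k * x j) / (x i - x j) := by
  have hf : (Finset.univ.filter fun p : Fin k × Fin k => twoOn J p.2 < twoOn J p.1) =
      J ×ˢ Jᶜ := by
    ext p
    rw [Finset.mem_filter]
    by_cases h1 : p.1 ∈ J <;> by_cases h2 : p.2 ∈ J <;> simp [twoOn, h1, h2]
  have hc : Finset.univ \ J.map w.toEmbedding = Jᶜ.map w.toEmbedding := by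
    rw [Finset.compl_eq_univ_sdiff, Finset.map_sdiff, Finset.map_univ_equiv]
  rw [term, hf, Finset.prod_product, hc]
  simp only [Finset.prod_map, Equiv.coe_toEmbedding]
  congr 1
  rw [← Finset.prod_subset (Finset.subset_univ J)]
  · exact Finset.prod_congr rfl fun i hi => by rw [twoOn, if_pos hi]
  · intro i _ hi
    rw [twoOn, if_neg hi, pow_zero]

theorem mem_stab_twoOn {k : ℕ} (J : Finset (Fin k)) (w : Equiv.Perm (Fin k)) :
    w ∈ stab (twoOn J) ↔ ∀ i, w i ∈ J ↔ i ∈ J := by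
  change (∀ i, twoOn J (w i) = twoOn J i) ↔ _
  refine forall_congr' fun i => ?_
  simp only [twoOn]
  split_ifs <;> simp_all

theorem map_eq_map_iff_mem_stab {k : ℕ} (J : Finset (Fin k)) (v w : Equiv.Perm (Fin k)) :
    J.map v.toEmbedding = J.map w.toEmbedding ↔ v⁻¹ * w ∈ stab (twoOn J) := by
  rw [mem_stab_twoOn, Finset.ext_iff, w.symm.forall_congr_left]
  refine forall_congr' fun i => ?_
  simp only [Finset.mem_map_equiv, Equiv.Perm.mul_apply]
  simp [Equiv.Perm.inv_def]

theorem exists_perm_map_eq {k : ℕ} {I J : Finset (Fin k)} (h : I.card = J.card) :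
    ∃ w : Equiv.Perm (Fin k), J.map w.toEmbedding = I := by
  have e : {i // i ∈ J} ≃ {i // i ∈ I} := Fintype.equivOfCardEq (by simp [h])
  refine ⟨e.extendSubtype, Finset.eq_of_subset_of_card_le (fun i hi => ?_) (by simp [h])⟩
  obtain ⟨j, hj, rfl⟩ := Finset.mem_map.mp hi
  exact e.extendSubtype_mem j hj

/-- Sending `w` to the image of `J` identifies the cosets of the stabiliser with the subsets of
cardinality `J.card`. -/
theorem ratP_twoOn {k : ℕ} (J : Finset (Fin k)) :
    ratP (twoOn J) = subsetSum (x : Fin k → RatFun k) (t k) Finset.univ J.card := by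
  classical
  rw [ratP, subsetSum]
  refine Finset.sum_bij (fun c _ => Quotient.liftOn' c (fun w => J.map w.toEmbedding)
    fun v w h => (map_eq_map_iff_mem_stab J v w).mpr (QuotientGroup.leftRel_apply.mp h))
    ?_ ?_ ?_ ?_
  · intro c _
    induction c using Quotient.inductionOn' with
    | h w => simp [Finset.mem_powersetCard]
  · intro c _ d _ h
    induction c using Quotient.inductionOn' with
    | h v =>
      induction d using Quotient.inductionOn' with
      | h w =>
        exact Quotient.sound' (QuotientGroup.leftRel_apply.mpr ((map_eq_map_iff_mem_stab J v w).mp h))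
  · intro I hI
    obtain ⟨w, hw⟩ := exists_perm_map_eq (Finset.mem_powersetCard.mp hI).2
    exact ⟨Quotient.mk'' w, Finset.mem_univ _, hw⟩
  · intro c _
    induction c using Quotient.inductionOn' with
    | h w => exact term_twoOn J w

theorem x_injective (k : ℕ) : Function.Injective (x : Fin k → RatFun k) :=
  (IsFractionRing.injective (Poly k) (RatFun k)).comp MvPolynomial.X_injective

theorem x_ne_zero {k : ℕ} (i : Fin k) : (x i : RatFun k) ≠ 0 := by
  rw [x, Ne, IsFractionRing.to_map_eq_zero_iff]
  exact MvPolynomial.X_ne_zero i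

theorem t_pow_ne_one (k m : ℕ) : t k ^ (m + 1) ≠ 1 := by
  rw [t, ← map_pow, ← map_pow, ← map_one (algebraMap (Poly k) (RatFun k)),
    ← map_one (MvPolynomial.C : Polynomial ℤ →+* Poly k)]
  intro h
  have h' := MvPolynomial.C_injective _ _ (IsFractionRing.injective (Poly k) (RatFun k) h)
  simpa using congrArg Polynomial.natDegree h'

/-- The expansion is proved for generic `t` and pulled back to the polynomial ring, so that any `t`
may be substituted later, including `t = q^0 = 1`, where the division by `1 - t ^ (r + 1)` would
fail. -/
theorem polyP_twoOn {k : ℕ} (J : Finset (Fin k)) :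
    polyP (twoOn J) = twoColSum (elemSym (MvPolynomial.X : Fin k → Poly k) Finset.univ)
      (MvPolynomial.C Polynomial.X) J.card := by
  apply IsFractionRing.injective (Poly k) (RatFun k)
  rw [algebraMap_polyP, ratP_twoOn, map_twoColSum]
  simp only [map_elemSym]
  exact subsetSum_eq_twoColSum (t_pow_ne_one k) _ (x_injective k).injOn fun i _ => x_ne_zero i

theorem mem_twoPow {r i j : ℕ} : (i, j) ∈ twoPow r ↔ i < r ∧ j < 2 := by
  rw [twoPow, YoungDiagram.mem_ofRowLens]
  simp

theorem rowLen_twoPow (r i : ℕ) : (twoPow r).rowLen i = if i < r then 2 else 0 := by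
  refine eq_of_forall_lt_iff fun j => ?_
  rw [← YoungDiagram.mem_iff_lt_rowLen, mem_twoPow]
  split_ifs with h <;> simp [h]

theorem colLen_twoPow (r : ℕ) : (twoPow r).colLen 0 = r := by
  refine eq_of_forall_lt_iff fun i => ?_
  rw [← YoungDiagram.mem_iff_lt_colLen, mem_twoPow]
  simp

theorem polyP_rowLen_twoPow {r k : ℕ} (h : r ≤ k) :
    polyP (fun i : Fin k => (twoPow r).rowLen i) =
      twoColSum (elemSym (MvPolynomial.X : Fin k → Poly k) Finset.univ)
        (MvPolynomial.C Polynomial.X) r := by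
  have hlam : (fun i : Fin k => (twoPow r).rowLen i) =
      twoOn (Finset.univ.filter fun i : Fin k => (i : ℕ) < r) := by
    funext i
    simp [twoOn, rowLen_twoPow]
  rw [hlam, polyP_twoOn, Fin.card_filter_val_lt, min_eq_right h]

/-! ### Independence of the number of variables -/

section Stability

variable {σ τ R : Type*} [CommRing R]

theorem elemSym_subset {S ι : Type*} [CommSemiring S] {x : ι → S} {s s' : Finset ι} (h : s ⊆ s')
    (h0 : ∀ i ∈ s', i ∉ s → x i = 0) (a : ℕ) : elemSym x s' a = elemSym x s a := by
  refine (Finset.sum_subset (Finset.powersetCard_mono h) fun A hA hA' => ?_).symm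
  obtain ⟨hAs, hAc⟩ := Finset.mem_powersetCard.mp hA
  have hns : ¬A ⊆ s := fun hs => hA' (Finset.mem_powersetCard.mpr ⟨hs, hAc⟩)
  obtain ⟨i, hi, his⟩ := Finset.not_subset.mp hns
  exact Finset.prod_eq_zero hi (h0 i (hAs hi) his)

theorem elemSym_map {S ι κ : Type*} [CommSemiring S] (f : ι ↪ κ) (x : κ → S) (s : Finset ι)
    (a : ℕ) : elemSym x (s.map f) a = elemSym (fun i => x (f i)) s a := by
  simp [elemSym, Finset.powersetCard_map]

theorem killCompl_elemSym [Fintype σ] [Fintype τ] {f : σ → τ} (hf : Function.Injective f) (a : ℕ) :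
    MvPolynomial.killCompl hf (elemSym (MvPolynomial.X : τ → MvPolynomial τ R) Finset.univ a) =
      elemSym MvPolynomial.X Finset.univ a := by
  classical
  refine (map_elemSym (MvPolynomial.killCompl (R := R) hf).toRingHom MvPolynomial.X
    Finset.univ a).trans ?_
  rw [elemSym_subset (Finset.subset_univ (Finset.univ.map ⟨f, hf⟩)), elemSym_map]
  · congr 1
    funext i
    change MvPolynomial.killCompl hf (MvPolynomial.X (f i)) = _
    rw [← MvPolynomial.rename_X f i, MvPolynomial.killCompl_rename_app]
  · intro i _ hi
    change MvPolynomial.killCompl hf (MvPolynomial.X i) = 0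
    rw [MvPolynomial.killCompl, MvPolynomial.aeval_X, dif_neg]
    exact fun ⟨j, hj⟩ => hi (Finset.mem_map.mpr ⟨j, Finset.mem_univ j, hj⟩)

/-- Stability: the coefficients of the expansion do not involve the number of variables, and each
`e_a` is stable under setting the extra variables to zero. -/
theorem killCompl_twoColSum [Fintype σ] [Fintype τ] {f : σ → τ} (hf : Function.Injective f) (c : R)
    (r : ℕ) :
    MvPolynomial.killCompl hf
        (twoColSum (elemSym MvPolynomial.X Finset.univ) (MvPolynomial.C c) r) =
      twoColSum (elemSym MvPolynomial.X Finset.univ) (MvPolynomial.C c) r := by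
  have h := map_twoColSum (MvPolynomial.killCompl (R := R) hf).toRingHom
    (elemSym MvPolynomial.X Finset.univ) (MvPolynomial.C c) r
  have hC : (MvPolynomial.killCompl hf).toRingHom (MvPolynomial.C c : MvPolynomial τ R) =
    MvPolynomial.C c := MvPolynomial.killCompl_C hf c
  rw [hC] at h
  refine h.trans ?_
  congr 1
  funext a
  exact killCompl_elemSym hf a

theorem coeff_killCompl {f : σ → τ} (hf : Function.Injective f) (p : MvPolynomial τ R)
    (m : σ →₀ ℕ) :
    MvPolynomial.coeff m (MvPolynomial.killCompl hf p) =
      MvPolynomial.coeff (m.mapDomain f) p := by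
  classical
  induction p using MvPolynomial.induction_on' with
  | monomial u c =>
    by_cases hu : (u.support : Set τ) ⊆ Set.range f
    · obtain ⟨v, rfl⟩ : ∃ v : σ →₀ ℕ, v.mapDomain f = u :=
        ⟨u.comapDomain f hf.injOn, Finsupp.mapDomain_comapDomain f hf u hu⟩
      rw [MvPolynomial.killCompl_monomial_mapDomain, MvPolynomial.coeff_monomial,
        MvPolynomial.coeff_monomial]
      simp only [(Finsupp.mapDomain_injective hf).eq_iff]
    · rw [MvPolynomial.killCompl_monomial_eq_zero_of_not_subset hf c hu, MvPolynomial.coeff_zero,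
        MvPolynomial.coeff_monomial, if_neg]
      rintro rfl
      refine hu fun i hi => ?_
      obtain ⟨j, -, hj⟩ := Finset.mem_image.mp (Finsupp.mapDomain_support hi)
      exact ⟨j, hj⟩
  | add p q hp hq => rw [map_add, MvPolynomial.coeff_add, hp, hq, MvPolynomial.coeff_add]

end Stability

/-- `symP` reads each coefficient in its own minimal number of variables; stability allows one
common `k` for all monomials in the first `k` variables. -/
theorem symP_twoPow {r k : ℕ} (h : r ≤ k) (m : Fin k →₀ ℕ) :
    MvPowerSeries.coeff (m.mapDomain Fin.val) (symP (twoPow r)) =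
      MvPolynomial.coeff m (twoColSum (elemSym (MvPolynomial.X : Fin k → Poly k) Finset.univ)
        (MvPolynomial.C Polynomial.X) r) := by
  set M : ℕ →₀ ℕ := m.mapDomain Fin.val with hM
  change MvPolynomial.coeff (M.comapDomain Fin.val Fin.val_injective.injOn)
    (polyP fun i : Fin (max ((twoPow r).colLen 0) (M.support.sup (· + 1))) =>
      (twoPow r).rowLen i) = _
  rw [colLen_twoPow]
  set k₀ := max r (M.support.sup (· + 1)) with hk₀
  have hk : k₀ ≤ k := by
    refine max_le h (Finset.sup_le fun i hi => ?_)
    obtain ⟨j, -, hj⟩ := Finset.mem_image.mp (Finsupp.mapDomain_support hi)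
    rw [← hj]
    exact j.2
  rw [polyP_rowLen_twoPow (le_max_left _ _), ← killCompl_twoColSum (Fin.castLE_injective hk),
    coeff_killCompl]
  congr 1
  apply Finsupp.mapDomain_injective Fin.val_injective
  rw [← Finsupp.mapDomain_comp, ← hM]
  refine Finsupp.mapDomain_comapDomain _ Fin.val_injective M fun i hi => ?_
  have hi' : i + 1 ≤ M.support.sup (· + 1) := Finset.le_sup (f := (· + 1)) hi
  exact ⟨⟨i, by omega⟩, rfl⟩

end HallLittlewood

namespace HallLittlewood

/-! ### Principal specialization of the expansion. -/

section Specialization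

variable {R : Type*} [CommRing R] {q : R} {ψ : ℕ → R}

theorem choose_two_succ (a : ℕ) : (a + 1).choose 2 = a.choose 2 + a := by
  rw [Nat.choose_succ_succ, Nat.choose_one_right, add_comm]

/-- `e_a(1, q, …, q^(k-1)) = q^(a(a-1)/2) (q; q)_k / ((q; q)_a (q; q)_{k-a})`. -/
theorem IsInvPoch.elemSym_pow_mul [IsDomain R] (h : IsInvPoch q ψ) (hq : ∀ m : ℕ, q ^ (m + 1) ≠ 1)
    (k : ℕ) : ∀ a ≤ k, elemSym (fun i : ℕ => q ^ i) (Finset.range k) a * ψ k =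
      q ^ a.choose 2 * ψ a * ψ (k - a) := by
  induction k with
  | zero =>
    intro a ha
    obtain rfl := Nat.le_zero.mp ha
    simp [elemSym_zero, h.zero]
  | succ k ih =>
    rintro (_ | a) ha
    · simp [elemSym_zero, h.zero]
    refine mul_left_cancel₀ (sub_ne_zero_of_ne (hq k).symm) ?_
    obtain ⟨b, rfl⟩ := Nat.exists_eq_add_of_le (Nat.le_of_succ_le_succ ha)
    have h2 := ih a (by omega)
    -- The factor `(1 - q ^ b) * ψ b` replaces `ψ (b - 1)` so that `b = 0`, where both sides vanish,
    -- is included.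
    have h1 : elemSym (fun i : ℕ => q ^ i) (Finset.range (a + b)) (a + 1) * ψ (a + b) =
        q ^ (a + 1).choose 2 * ψ (a + 1) * ((1 - q ^ b) * ψ b) := by
      rcases b with _ | b
      · rw [elemSym_eq_zero _ (by simp)]
        simp
      · rw [ih (a + 1) (by omega), ← h.succ b, show a + (b + 1) - (a + 1) = b by omega]
    rw [Nat.add_sub_cancel_left] at h2
    rw [mul_left_comm, ← h.succ, Finset.range_add_one, elemSym_insert _ Finset.notMem_range_self,
      add_mul, h1, mul_assoc (q ^ (a + b)), h2, h.succ a, choose_two_succ,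
      show a + b + 1 - (a + 1) = b by omega]
    ring

theorem IsInvPoch.pow_dvd_sub (h : IsInvPoch q ψ) (m k : ℕ) :
    q ^ (m + 1) ∣ ψ (m + k) - ψ m := by
  induction k with
  | zero => simp
  | succ k ih =>
    have h1 : ψ (m + (k + 1)) - ψ m = (ψ (m + k) - ψ m) + q ^ (m + 1) * (q ^ k * ψ (m + k + 1)) := by
      rw [h.succ (m + k), ← add_assoc]
      ring
    rw [h1]
    exact dvd_add ih (dvd_mul_right _ _)

/-- The exact value is `q^(a(a-1)/2) ψ a` times `ψ (k - a) / ψ k`, and this ratio is 1 modulo `q ^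
(k - a + 1)`. -/
theorem IsInvPoch.pow_dvd_elemSym_sub [IsDomain R] (h : IsInvPoch q ψ)
    (hq : ∀ m : ℕ, q ^ (m + 1) ≠ 1) (hu : ∀ m, IsUnit (ψ m)) {d k a : ℕ} (hk : d + a ≤ k) :
    q ^ (d + 1) ∣ elemSym (fun i : ℕ => q ^ i) (Finset.range k) a - q ^ a.choose 2 * ψ a := by
  obtain ⟨b, rfl⟩ := Nat.exists_eq_add_of_le hk
  rw [← (hu (d + a + b)).dvd_mul_right, sub_mul, h.elemSym_pow_mul hq _ _ (by omega), ← mul_sub,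
    show d + a + b - a = d + b by omega]
  refine Dvd.dvd.mul_left ?_ _
  rw [show d + a + b = d + b + a by omega, dvd_sub_comm]
  exact (pow_dvd_pow q (by omega)).trans (h.pow_dvd_sub (d + b) a)

theorem dvd_twoColSum_sub {c t : R} {e e' : ℕ → R} {r : ℕ}
    (h : ∀ a ≤ 2 * r, c ∣ e a - e' a) : c ∣ twoColSum e t r - twoColSum e' t r := by
  have hp : ∀ j, c ∣ elemProd e r j - elemProd e' r j := by
    intro j
    rw [elemProd, elemProd]
    split_ifs with hj
    · have h1 := h (r - j) (by omega)
      have h2 := h (r + j) (by omega)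
      have h3 : e (r - j) * e (r + j) - e' (r - j) * e' (r + j) =
          (e (r - j) - e' (r - j)) * e (r + j) + e' (r - j) * (e (r + j) - e' (r + j)) := by ring
      rw [h3]
      exact dvd_add (h1.mul_right _) (h2.mul_left _)
    · simp
  rw [twoColSum, twoColSum, ← Finset.sum_sub_distrib]
  refine Finset.dvd_sum fun j _ => ?_
  rw [← mul_sub]
  refine Dvd.dvd.mul_left ?_ _
  rw [sub_sub_sub_comm]
  exact dvd_sub (hp j) (hp (j + 1))

theorem choose_two_add_choose_two (a j : ℕ) :
    a.choose 2 + (a + 2 * j).choose 2 = (a + j) ^ 2 - (a + j) + j ^ 2 := by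
  have h1 := two_mul_choose_two a
  have h2 := two_mul_choose_two (a + 2 * j)
  rw [choose_two_succ] at h1 h2
  have h3 : a.choose 2 + (a + 2 * j).choose 2 + (a + j) = (a + j) ^ 2 + j ^ 2 := by nlinarith
  have h4 : a + j ≤ (a + j) ^ 2 := Nat.le_self_pow two_ne_zero _
  omega

/-- Term by term: over the common factor `ψ (r - j) * ψ (r + j + 1)`, the difference of consecutive
products leaves `(1 - q^(r+j+1)) - q^(2j+1) (1 - q^(r-j)) = 1 - q^(2j+1)`. -/
theorem IsInvPoch.twoColSum_eq (h : IsInvPoch q ψ) (N r : ℕ) :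
    twoColSum (fun a => q ^ a.choose 2 * ψ a) (q ^ N) r =
      q ^ (r ^ 2 - r) * baileySum ψ (hlAlpha q N) r := by
  rw [twoColSum, baileySum, Finset.mul_sum]
  refine Finset.sum_congr rfl fun j hj => ?_
  obtain ⟨a, rfl⟩ := Nat.exists_eq_add_of_le' (Nat.lt_succ_iff.mp (Finset.mem_range.mp hj))
  have e1 : elemProd (fun a => q ^ a.choose 2 * ψ a) (a + j) j =
      q ^ ((a + j) ^ 2 - (a + j) + j ^ 2) * (ψ a * ψ (a + j + j)) := by
    rw [elemProd, if_pos (by omega), Nat.add_sub_cancel, ← choose_two_add_choose_two, pow_add,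
      show a + 2 * j = a + j + j by omega]
    ring
  -- The factor `1 - q ^ a` also covers `a = 0`, where `elemProd` is zero by definition.
  have e2 : elemProd (fun a => q ^ a.choose 2 * ψ a) (a + j) (j + 1) =
      q ^ ((a + j) ^ 2 - (a + j) + (j + 1) ^ 2) * ((1 - q ^ a) * ψ a * ψ (a + j + j + 1)) := by
    rcases a with _ | a
    · rw [elemProd, if_neg (by omega)]
      simp
    · have hc := choose_two_add_choose_two a (j + 1)
      rw [show a + (j + 1) = a + 1 + j by omega] at hc
      rw [elemProd, if_pos (by omega), show a + 1 + j - (j + 1) = a by omega, ← h.succ, ← hc,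
        pow_add, show a + 2 * (j + 1) = a + 1 + j + j + 1 by omega,
        show a + 1 + j + (j + 1) = a + 1 + j + j + 1 by omega]
      ring
  rw [e1, e2, h.succ (a + j + j), Nat.add_sub_cancel, hlAlpha, ← pow_mul]
  ring

end Specialization

/-! ### The multisum and the convergence in `ℤ⟦q⟧`. -/

section PowerSeries

theorem X_pow_succ_ne_one (m : ℕ) : (PowerSeries.X : PowerSeries ℤ) ^ (m + 1) ≠ 1 := by
  intro h
  have := congrArg PowerSeries.constantCoeff h
  simp at this

theorem invQPoch_natCast (b m : ℕ) :
    invQPoch b m = Ring.inverse (qPoch (PowerSeries.X ^ b) (PowerSeries.X ^ b) m) := by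
  rw [invQPoch, if_pos (Int.natCast_nonneg m), Int.toNat_natCast]

theorem isInvPoch_invQPoch {b : ℕ} (hb : 0 < b) :
    IsInvPoch ((PowerSeries.X : PowerSeries ℤ) ^ b) fun m : ℕ => invQPoch b m where
  zero := (invQPoch_natCast b 0).trans (by simp [qPoch])
  succ m := by
    have h1 := Ring.inverse_mul_cancel _ (isUnit_qPoch hb m)
    have h2 := Ring.inverse_mul_cancel _ (isUnit_qPoch hb (m + 1))
    have hs : qPoch (PowerSeries.X ^ b) (PowerSeries.X ^ b) (m + 1) =
        qPoch (PowerSeries.X ^ b) (PowerSeries.X ^ b) m *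
          (1 - (PowerSeries.X ^ b) ^ (m + 1)) := by
      rw [qPoch, Finset.prod_range_succ, pow_succ' (PowerSeries.X ^ b)]
      rfl
    simp only [invQPoch_natCast]
    refine (isUnit_qPoch hb m).mul_right_cancel ?_
    nth_rw 2 [hs] at h2
    exact h1.trans (h2.symm.trans (by ring))

theorem isUnit_invQPoch {b : ℕ} (hb : 0 < b) (m : ℕ) : IsUnit (invQPoch b m) := by
  rw [invQPoch_natCast]
  exact (isUnit_qPoch hb m).ringInverse

theorem isInvPoch_invQPoch_one :
    IsInvPoch (PowerSeries.X : PowerSeries ℤ) fun m : ℕ => invQPoch 1 m := by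
  simpa using isInvPoch_invQPoch one_pos

theorem finsum_fin_succ {M : Type*} [AddCommMonoid M] {n : ℕ} (f : (Fin (n + 1) → ℕ) → M)
    (hf : (Function.support f).Finite) :
    ∑ᶠ ρ, f ρ = ∑ᶠ (s : ℕ) (ρ : Fin n → ℕ), f (Fin.cons s ρ) := by
  rw [← finsum_comp_equiv (Fin.consEquiv fun _ => ℕ)]
  refine (finsum_curry _ ?_).trans ?_
  · exact hf.preimage (Fin.consEquiv fun _ => ℕ).injective.injOn
  · rfl

/-- The summand of the multisum without the factor `q^(r² - r)`. -/
noncomputable def reducedSummand (r n b : ℕ) (ρ : Fin n → ℕ) : PowerSeries ℤ :=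
  let c : Fin (n + 1) → ℕ := Fin.cons r ρ
  PowerSeries.X ^ (∑ i, (ρ i ^ 2 + ρ i)) *
    (∏ i : Fin n, invQPoch 1 ((c i.castSucc : ℤ) - (c i.succ : ℤ))) * invQPoch b (c (Fin.last n))

theorem summand_eq (r n b : ℕ) (ρ : Fin n → ℕ) :
    summand r n b ρ = PowerSeries.X ^ (r ^ 2 - r) * reducedSummand r n b ρ := by
  rw [summand, reducedSummand, pow_add]
  ring

theorem finite_support_reducedSummand (r n b : ℕ) :
    (Function.support (reducedSummand r n b)).Finite := by
  refine (finite_support_summand r n b).subset fun ρ hρ => ?_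
  rw [Function.mem_support, summand_eq]
  exact mul_ne_zero (pow_ne_zero _ PowerSeries.X_ne_zero) hρ

/-- Without `q^(r²-r)`, splitting off `r₁ = s` leaves a summand of the same kind with `s` in the
role of `r`. -/
theorem reducedSummand_cons (r n b s : ℕ) (ρ : Fin n → ℕ) :
    reducedSummand r (n + 1) b (Fin.cons s ρ) =
      PowerSeries.X ^ (s ^ 2 + s) * invQPoch 1 ((r : ℤ) - s) * reducedSummand s n b ρ := by
  simp only [reducedSummand, Fin.sum_univ_succ, Fin.prod_univ_succ, Fin.cons_succ, Fin.cons_zero,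
    Fin.castSucc_zero, ← Fin.succ_castSucc, ← Fin.succ_last, pow_add]
  ring

theorem finsum_reducedSummand_succ (r n b : ℕ) :
    ∑ᶠ ρ, reducedSummand r (n + 1) b ρ = ∑ s ∈ Finset.range (r + 1),
      PowerSeries.X ^ (s ^ 2 + s) * invQPoch 1 ((r - s : ℕ) : ℤ) *
        ∑ᶠ ρ, reducedSummand s n b ρ := by
  rw [finsum_fin_succ _ (finite_support_reducedSummand r (n + 1) b)]
  simp only [reducedSummand_cons, ← mul_finsum]
  rw [finsum_eq_sum_of_support_subset _ (s := Finset.range (r + 1))]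
  · refine Finset.sum_congr rfl fun s hs => ?_
    rw [Nat.cast_sub (Nat.lt_succ_iff.mp (Finset.mem_range.mp hs))]
  · intro s hs
    by_contra hsr
    refine hs ?_
    have hlt : ¬(0 : ℤ) ≤ (r : ℤ) - s := by
      simp only [Finset.coe_range, Set.mem_Iio] at hsr
      omega
    simp only [invQPoch, if_neg hlt, mul_zero, zero_mul]

theorem baileySum_hlAlpha_zero (r : ℕ) :
    baileySum (fun m : ℕ => invQPoch 1 m) (hlAlpha PowerSeries.X 0) r = invQPoch 2 r := by
  induction r with
  | zero =>
    rw [isInvPoch_invQPoch_one.baileySum_zero]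
    exact (isInvPoch_invQPoch two_pos).zero.symm
  | succ r ih =>
    refine mul_left_cancel₀ (sub_ne_zero_of_ne (X_pow_succ_ne_one (2 * r + 1)).symm) ?_
    have h := (isInvPoch_invQPoch two_pos).succ r
    rw [← pow_mul] at h
    rw [show 2 * r + 1 + 1 = 2 * (r + 1) by omega,
      isInvPoch_invQPoch_one.baileySum_hlAlpha_zero_succ, ih]
    exact h

/-- Induction on `n`: the sum over `r₁` is one Bailey step, and `n = 0` is the evaluation at `N =
δ`. -/
theorem finsum_reducedSummand {δ : ℕ} (hδ : δ = 0 ∨ δ = 1) (n : ℕ) :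
    ∀ r, ∑ᶠ ρ, reducedSummand r n (2 - δ) ρ =
      baileySum (fun m : ℕ => invQPoch 1 m) (hlAlpha PowerSeries.X (2 * n + δ)) r := by
  induction n with
  | zero =>
    intro r
    rw [finsum_unique]
    have h0 : ∀ ρ, reducedSummand r 0 (2 - δ) ρ = invQPoch (2 - δ) r := fun ρ => by
      simp [reducedSummand]
    rw [h0, mul_zero, zero_add]
    rcases hδ with rfl | rfl
    · exact (baileySum_hlAlpha_zero r).symm
    · exact (isInvPoch_invQPoch_one.baileySum_hlAlpha_one X_pow_succ_ne_one r).symm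
  | succ n ih =>
    intro r
    rw [finsum_reducedSummand_succ, show 2 * (n + 1) + δ = 2 * n + δ + 2 by omega,
      isInvPoch_invQPoch_one.baileySum_hlAlpha_add_two X_pow_succ_ne_one]
    simp only [ih]

theorem finsum_summand {δ : ℕ} (hδ : δ = 0 ∨ δ = 1) (r n : ℕ) :
    ∑ᶠ ρ, summand r n (2 - δ) ρ =
      twoColSum (fun a => PowerSeries.X ^ a.choose 2 * invQPoch 1 a)
        (PowerSeries.X ^ (2 * n + δ)) r := by
  rw [isInvPoch_invQPoch_one.twoColSum_eq, ← finsum_reducedSummand hδ, mul_finsum]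
  simp only [summand_eq]

/-- The principal specialization can be computed from finitely many variables, one coefficient
at a time. -/
theorem hasSum_coeff_of_finite_variables {F : MvPowerSeries ℕ (Polynomial ℤ)} {d k : ℕ}
    (hd : d < k) {P : Poly k}
    (hP : ∀ m : Fin k →₀ ℕ, MvPowerSeries.coeff (m.mapDomain Fin.val) F = MvPolynomial.coeff m P)
    (T : PowerSeries ℤ) :
    HasSum (fun m : ℕ →₀ ℕ => PowerSeries.coeff d (Polynomial.aeval T (MvPowerSeries.coeff m F) *
        m.prod fun i e => ((PowerSeries.X : PowerSeries ℤ) ^ i) ^ e))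
      (PowerSeries.coeff d (MvPolynomial.eval₂ (Polynomial.aeval T).toRingHom
        (fun i : Fin k => (PowerSeries.X : PowerSeries ℤ) ^ (i : ℕ)) P)) := by
  have hinj : Function.Injective (Finsupp.mapDomain (M := ℕ) (Fin.val : Fin k → ℕ)) :=
    Finsupp.mapDomain_injective Fin.val_injective
  have hsum : PowerSeries.coeff d (MvPolynomial.eval₂ (Polynomial.aeval T).toRingHom
        (fun i : Fin k => (PowerSeries.X : PowerSeries ℤ) ^ (i : ℕ)) P) =
      ∑ m ∈ P.support.map ⟨_, hinj⟩,
        PowerSeries.coeff d (Polynomial.aeval T (MvPowerSeries.coeff m F) *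
          m.prod fun i e => ((PowerSeries.X : PowerSeries ℤ) ^ i) ^ e) := by
    rw [MvPolynomial.eval₂_eq, map_sum, Finset.sum_map]
    refine Finset.sum_congr rfl fun m _ => ?_
    simp only [Function.Embedding.coeFn_mk]
    rw [hP, Finsupp.prod_mapDomain_index_inj Fin.val_injective]
    rfl
  rw [hsum]
  refine hasSum_sum_of_ne_finset_zero fun m hm => ?_
  by_cases hs : (m.support : Set ℕ) ⊆ Set.range (Fin.val : Fin k → ℕ)
  · obtain ⟨u, rfl⟩ : ∃ u : Fin k →₀ ℕ, u.mapDomain Fin.val = m :=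
      ⟨m.comapDomain _ Fin.val_injective.injOn, Finsupp.mapDomain_comapDomain _ Fin.val_injective m hs⟩
    have hu : u ∉ P.support := fun hu => hm (Finset.mem_map_of_mem ⟨_, hinj⟩ hu)
    rw [hP, MvPolynomial.notMem_support_iff.mp hu, map_zero, zero_mul, map_zero]
  -- A monomial containing a variable of index `i ≥ k > d` specializes to a multiple of `q ^ i`, so
  -- it does not reach degree `d`.
  · obtain ⟨i, hi, hik⟩ := Set.not_subset.mp hs
    have hki : k ≤ i := by
      by_contra hlt
      exact hik ⟨⟨i, by omega⟩, rfl⟩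
    have hdvd : (PowerSeries.X : PowerSeries ℤ) ^ i ∣
        m.prod fun i e => ((PowerSeries.X : PowerSeries ℤ) ^ i) ^ e :=
      (dvd_pow_self _ (Finsupp.mem_support_iff.mp hi)).trans (Finset.dvd_prod_of_mem _ hi)
    exact PowerSeries.X_pow_dvd_iff.mp (hdvd.mul_left _) d (by omega)

theorem hasPrincipalSpecialization_symP_twoPow (r N : ℕ) :
    HasPrincipalSpecialization (symP (twoPow r)) (PowerSeries.X ^ N)
      (twoColSum (fun a => PowerSeries.X ^ a.choose 2 * invQPoch 1 a) (PowerSeries.X ^ N) r) := by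
  refine (PowerSeries.WithPiTopology.hasSum_iff_hasSum_coeff ℤ).mpr fun d => ?_
  -- With `d + 2r + 1` variables, every `e_a` with `a ≤ 2r`, hence the whole expansion, agrees with
  -- its limit modulo `q ^ (d + 1)`.
  have hk : d < d + 2 * r + 1 := by omega
  have h := hasSum_coeff_of_finite_variables hk
    (symP_twoPow (show r ≤ d + 2 * r + 1 by omega)) (PowerSeries.X ^ N)
  have he := map_twoColSum (R := Poly (d + 2 * r + 1)) (S := PowerSeries ℤ)
    (MvPolynomial.eval₂Hom (Polynomial.aeval (R := ℤ) ((PowerSeries.X : PowerSeries ℤ) ^ N)).toRingHom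
      (fun i : Fin (d + 2 * r + 1) => (PowerSeries.X : PowerSeries ℤ) ^ (i : ℕ)))
    (elemSym MvPolynomial.X Finset.univ) (MvPolynomial.C Polynomial.X) r
  simp only [map_elemSym, MvPolynomial.coe_eval₂Hom, MvPolynomial.eval₂_X,
    MvPolynomial.eval₂_C] at he
  have hT : (Polynomial.aeval (R := ℤ) ((PowerSeries.X : PowerSeries ℤ) ^ N)).toRingHom Polynomial.X =
    PowerSeries.X ^ N := Polynomial.aeval_X _
  rw [hT] at he
  rw [he] at h
  refine (sub_eq_zero.mp ?_ : PowerSeries.coeff (R := ℤ) d _ = PowerSeries.coeff d _) ▸ h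
  rw [← map_sub]
  refine PowerSeries.X_pow_dvd_iff.mp (dvd_twoColSum_sub fun a ha => ?_) d (Nat.lt_succ_self d)
  have hr : elemSym (fun i : Fin (d + 2 * r + 1) => (PowerSeries.X : PowerSeries ℤ) ^ (i : ℕ))
      Finset.univ a =
      elemSym (fun i : ℕ => (PowerSeries.X : PowerSeries ℤ) ^ i)
        (Finset.range (d + 2 * r + 1)) a := by
    rw [← Nat.Iio_eq_range, ← Fin.map_valEmbedding_univ, elemSym_map]
    rfl
  rw [hr]
  exact isInvPoch_invQPoch_one.pow_dvd_elemSym_sub X_pow_succ_ne_one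
    (isUnit_invQPoch one_pos) (by omega)

end PowerSeries

end HallLittlewood

theorem mainTheorem7 (r n δ : ℕ) (hδ : δ = 0 ∨ δ = 1) :
    HallLittlewood.HasPrincipalSpecialization
      (HallLittlewood.symP (HallLittlewood.twoPow r))
      ((PowerSeries.X : PowerSeries ℤ) ^ (2 * n + δ))
      (∑ᶠ ρ : Fin n → ℕ, HallLittlewood.summand r n (2 - δ) ρ) := by
  rw [HallLittlewood.finsum_summand hδ]
  exact HallLittlewood.hasPrincipalSpecialization_symP_twoPow r (2 * n + δ)
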